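/- Let $R$ be a commutative Noetherian ring which is indecomposable, i.e. not isomorphic to a product of two nonzero rings. Let $\mathrm{Perf}(R)$ be the full subcategory of the unbounded derived category $D(R\text{-}\mathrm{Mod})$ consisting of the complexes quasi-isomorphic to bounded complexes of finitely generated projective $R$-modules. Let $\mathcal T\subset \mathrm{Perf}(R)$ be a thick subcategory, i.e. a full triangulated subcategory such that every object of $\mathrm{Perf}(R)$ which is a direct summand of an object of $\mathcal T$ belongs to $\mathcal T$. Suppose that the triangulated category $\mathcal T$ is regular, i.e. that there are an object $G\in\mathcal T$ and an integer $n\ge 0$ with $\mathcal T=\langle G\rangle_n$. Here $[G]_0$ consists of the finite direct sums of shifts of $G$ in $\mathcal T$; for $k\ge 1$, $[G]_k$ consists of the objects $F\in\mathcal T$ for which there is a distinguished triangle $F_{k-1}\to F\to F_0\to F_{k-1}[1]$ with $F_{k-1}\in [G]_{k-1}$ and $F_0\in[G]_0$; and $\langle G\rangle_n$ consists of the direct summands in $\mathcal T$ of the objects of $[G]_n$. Then $\mathcal T=0$ (that is, $\mathcal T$ consists exactly of the zero objects) or $\mathcal T=\mathrm{Perf}(R)$. -/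

import Mathlib

open CategoryTheory

universe w u

/-- A commutative ring is indecomposable if it is not isomorphic to a product of two nonzero
rings. (Both factors are quotients of `R`, so it suffices to let them range over the universe
of `R`.) -/
def IsIndecomposableRing (R : Type u) [CommRing R] : Prop :=
  ∀ (A B : Type u) [CommRing A] [CommRing B], Nonempty (R ≃+* A × B) →
    Subsingleton A ∨ Subsingleton B

/-- The category `Perf(R)`, as a strictly full subcategory of the unbounded derived category
`D(R-Mod)`: the complexes which are isomorphic in `D(R-Mod)` (that is, quasi-isomorphic) to a
bounded complex of finitely generated projective modules. -/
def Perf (R : Type u) [CommRing R] [HasDerivedCategory.{w} (ModuleCat.{u} R)] :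
    ObjectProperty (DerivedCategory (ModuleCat.{u} R)) := fun X =>
  ∃ K : CochainComplex (ModuleCat.{u} R) ℤ,
    (∃ a b : ℤ, K.IsStrictlyGE a ∧ K.IsStrictlyLE b) ∧
    (∀ i : ℤ, Module.Finite R (K.X i) ∧ Module.Projective R (K.X i)) ∧
    Nonempty (X ≅ DerivedCategory.Q.obj K)

/-- `T` is a full subcategory of the full subcategory `P` of `C`, and any object of `P` which is a
direct summand of an object of `T` belongs to `T`. (In particular, `T` is closed under
isomorphisms in `P`.) -/
structure IsThickIn {C : Type*} [Category* C] (T P : ObjectProperty C) : Prop where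
  le : T ≤ P
  of_retract : ∀ ⦃X Y : C⦄, P X → T Y → Retract X Y → T X

/-- A triangulated category is regular if it has a strong generator: an object `G` such that, for
some fixed `n`, every object is a direct summand of an object obtained by `n` successive extensions
from (direct summands of) finite direct sums of shifts of `G`. -/
def IsRegularTriangulated (C : Type*) [Category* C] [Limits.HasZeroObject C] [HasShift C ℤ]
    [Preadditive C] [∀ n : ℤ, (shiftFunctor C n).Additive] [Pretriangulated C] : Prop :=
  ∃ G : C, (ObjectProperty.singleton G).IsStrongTriangulatedGenerator

/-!
Let `G` be a strong generator of `T`, say with `n` extensions, and let `I` be the annihilator of `G`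
in `R`. Extensions multiply annihilators, so `I ^ (n + 1)` annihilates every object of `T`
(`triangEnvelopeIter_le_annihilatedBy`). The point is to show that `T` has objects which are
annihilated by few elements: for every `m`, the projection `R → R ⧸ I ^ m` in the derived category
factors through an object of `T`. This gives `I ^ (n + 1) ≤ I ^ m` for all `m`
(`mem_of_annihilatedBy`), so `I ^ (n + 1)` is idempotent, hence generated by an idempotent, which is
`0` or `1` as `R` is indecomposable. If it is `1`, then `T = 0`. If it is `0`, then *all* morphisms
from perfect complexes to bounded complexes of finitely generated modules factor through objects of
`T`; for the identity of a perfect complex this says that the complex is a direct summand of an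
object of `T` (`IsThickIn.perf_le`).

Call a morphism negligible if it factors through an object of `T`, i.e. if it vanishes in the
Verdier quotient. Objects `M` such that all morphisms to `M` from objects of bounded projective
amplitude are negligible are stable under shifts and extensions (`negligibleFrom_of_triangle`). That
`R ⧸ J` is such an object whenever `J` contains a power of `I` follows by Noetherian induction on
`J` (`negligibleModule_quotient`), the essential case being a prime `J = p` containing `I`:

* Represent `G` by a bounded complex `K` of finitely generated projective modules. As `p` contains
  the annihilator, `K` is not contractible locally at `p`, and Nakayama's lemma provides a cycle `z`
  of `K` and a linear form `φ` with values in `R ⧸ p`, vanishing on boundaries, such that `φ z ≠ 0`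
  (`exists_cycle_apply_ne_zero`). So multiplication by some `s ∉ p` on `R ⧸ p` factors, up to
  a shift, through `K ⊗ R ⧸ p`.
* Morphisms from a perfect complex to `K ⊗ M`, with `M` finitely generated, are negligible
  (`negligibleFrom_tensorComplex`): resolve `M` by finite free modules `F`, for which `K ⊗ F` is in
  `T`, and use that a perfect complex sees only finitely many terms of the resolution.
* Hence `s • f` is negligible for `f : X → R ⧸ p`, and the triangle over
  `s : R ⧸ p → R ⧸ p → R ⧸ (p + (s))` reduces `f` to the larger ideal `p + (s)`.
-/

open CategoryTheory Limits Pretriangulated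

/-! ### Linear forms on a finitely generated module at a prime -/

/-- A finitely generated module whose localization at a prime `p` is nonzero has a nonzero linear
map to `R ⧸ p`: by Nakayama its fibre at `p` is a nonzero vector space, and a nonzero functional on
the fibre takes values in `R ⧸ p` on the module after clearing denominators. -/
theorem exists_linearMap_quotient_ne_zero {R : Type*} [CommRing R] {N : Type*} [AddCommGroup N]
    [Module R N] [Module.Finite R N] (p : Ideal R) [hp : p.IsPrime]
    (h : ∀ s ∉ p, ∃ n : N, s • n ≠ 0) : ∃ ψ : N →ₗ[R] R ⧸ p, ψ ≠ 0 := by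
  let P : PrimeSpectrum R := ⟨p, hp⟩
  have hsupp : P ∈ Module.support R N := by
    rw [Module.mem_support_iff_of_finite]
    intro s hs
    by_contra hsp
    obtain ⟨n, hn⟩ := h s hsp
    exact hn (Module.mem_annihilator.1 hs n)
  rw [Module.mem_support_iff_nontrivial_residueField_tensorProduct] at hsupp
  let K := P.asIdeal.ResidueField
  have hf : ∃ f : TensorProduct R K N →ₗ[K] K, f ≠ 0 := by
    obtain ⟨v, hv⟩ := exists_ne (0 : TensorProduct R K N)
    by_contra! hall
    exact hv ((Module.forall_dual_apply_eq_zero_iff K v).1 fun f ↦ by rw [hall f]; rfl)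
  obtain ⟨f, hf⟩ := hf
  let g : N →ₗ[R] K := f.restrictScalars R ∘ₗ TensorProduct.mk R K N 1
  have hg : g ≠ 0 := by
    intro hg
    apply hf
    ext n
    simpa [g] using LinearMap.congr_fun hg n
  obtain ⟨S, hS⟩ := Module.Finite.fg_top (R := R) (M := N)
  obtain ⟨⟨b, hb⟩, hbS⟩ := IsLocalization.exist_integer_multiples
    (nonZeroDivisors (R ⧸ P.asIdeal)) S (fun n ↦ g n)
  let ι : (R ⧸ P.asIdeal) →ₗ[R] K := (Algebra.linearMap (R ⧸ P.asIdeal) K).restrictScalars R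
  have hι : Function.Injective ι := IsFractionRing.injective (R ⧸ P.asIdeal) K
  let m : K →ₗ[R] K := (LinearMap.lsmul (R ⧸ P.asIdeal) K b).restrictScalars R
  have hm : Function.Injective m := by
    intro x y hxy
    have hb0 : algebraMap (R ⧸ P.asIdeal) K b ≠ 0 :=
      IsFractionRing.to_map_ne_zero_of_mem_nonZeroDivisors hb
    simpa [m, Algebra.smul_def, hb0] using hxy
  have hrange : ∀ n, (m ∘ₗ g) n ∈ LinearMap.range ι := by
    intro n
    have : (⊤ : Submodule R N) ≤ (LinearMap.range ι).comap (m ∘ₗ g) := by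
      rw [← hS, Submodule.span_le]
      intro n hn
      obtain ⟨y, hy⟩ := hbS n hn
      exact ⟨y, hy⟩
    exact this trivial
  refine ⟨(LinearEquiv.ofInjective ι hι).symm.toLinearMap ∘ₗ (m ∘ₗ g).codRestrict _ hrange, ?_⟩
  intro h0
  apply hg
  ext n
  apply hm
  have h1 := LinearMap.congr_fun h0 n
  have h2 := (LinearEquiv.map_eq_zero_iff (LinearEquiv.ofInjective ι hι).symm).1 h1
  simpa using congrArg Subtype.val h2

/-! ### Annihilators in linear triangulated categories -/

section Annihilators

variable {R : Type*} [CommRing R] {C : Type*} [Category* C] [Preadditive C] [Linear R C]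

/-- The objects of an `R`-linear category on which every element of the ideal `J` acts by zero. -/
def annihilatedBy (C : Type*) [Category* C] [Preadditive C] [Linear R C] (J : Ideal R) :
    ObjectProperty C :=
  fun X ↦ ∀ a ∈ J, a • 𝟙 X = 0

instance (J : Ideal R) : (annihilatedBy C J).IsStableUnderRetracts where
  of_retract {X Y} r hY a ha := by
    calc a • 𝟙 X = r.i ≫ (a • 𝟙 Y) ≫ r.r := by simp
      _ = 0 := by rw [hY a ha]; simp

instance (J : Ideal R) : (annihilatedBy C J).IsClosedUnderLimitsOfShape
    (Discrete WalkingPair) where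
  limitsOfShape_le := by
    rintro X ⟨p⟩ a ha
    refine p.isLimit.hom_ext fun j ↦ ?_
    have h := p.prop_diag_obj j a ha
    have h' : (a • 𝟙 X) ≫ p.π.app j = p.π.app j ≫ (a • 𝟙 (p.diag.obj j)) := by simp
    exact h'.trans (by rw [h]; simp)

instance [HasZeroObject C] (J : Ideal R) : (annihilatedBy C J).ContainsZero where
  exists_zero := ⟨_, isZero_zero C, fun _ _ ↦ (isZero_zero C).eq_of_src _ _⟩

instance [HasShift C ℤ] [∀ n : ℤ, (shiftFunctor C n).Additive]
    [∀ n : ℤ, (shiftFunctor C n).Linear R] (J : Ideal R) :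
    (annihilatedBy C J).IsStableUnderShift ℤ where
  isStableUnderShiftBy n :=
    { le_shift := fun X hX a ha ↦ by
        have h := congrArg (shiftFunctor C n).map (hX a ha)
        rwa [CategoryTheory.Functor.map_smul, CategoryTheory.Functor.map_id,
          Functor.map_zero] at h }

variable [HasZeroObject C] [HasShift C ℤ] [∀ n : ℤ, (shiftFunctor C n).Additive]
  [Pretriangulated C]

theorem annihilatedBy_mul_of_triangle {T : Triangle C} (hT : T ∈ distTriang C) {J J' : Ideal R}
    (h₁ : annihilatedBy C J T.obj₁) (h₃ : annihilatedBy C J' T.obj₃) :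
    annihilatedBy C (J * J') T.obj₂ := by
  intro x hx
  refine Submodule.mul_induction_on hx (fun a ha b hb ↦ ?_) (fun x y hx hy ↦ ?_)
  · obtain ⟨g, hg⟩ := Triangle.coyoneda_exact₂ T hT (b • 𝟙 T.obj₂) (by
      calc (b • 𝟙 T.obj₂) ≫ T.mor₂ = T.mor₂ ≫ (b • 𝟙 T.obj₃) := by simp
        _ = 0 := by rw [h₃ b hb]; simp)
    calc (a * b) • 𝟙 T.obj₂ = a • (b • 𝟙 T.obj₂) := by rw [smul_smul]
      _ = g ≫ (a • 𝟙 T.obj₁) ≫ T.mor₁ := by rw [hg]; simp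
      _ = 0 := by rw [h₁ a ha]; simp
  · rw [add_smul, hx, hy, add_zero]

variable [∀ n : ℤ, (shiftFunctor C n).Linear R] [HasTerminal C]

/-- An ideal annihilating `G` annihilates, after raising it to the power `n + 1`, every object
obtained from `G` by `n` extensions. -/
theorem triangEnvelopeIter_le_annihilatedBy {P : ObjectProperty C} {J : Ideal R}
    (hP : P ≤ annihilatedBy C J) (n : ℕ) :
    P.triangEnvelopeIter n ≤ annihilatedBy C (J ^ (n + 1)) := by
  have h0 : (P.shiftClosure ℤ).binaryProductsClosure.retractClosure ≤ annihilatedBy C J := by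
    rwa [ObjectProperty.retractClosure_le_iff, ObjectProperty.binaryProductsClosure_le_iff,
      ObjectProperty.shiftClosure_le_iff]
  induction n with
  | zero => simpa using h0
  | succ n ih =>
    rw [ObjectProperty.triangEnvelopeIter_succ, ObjectProperty.retractClosure_le_iff]
    rintro X ⟨Y, Z, f, g, h, hT, hY, hZ⟩
    rw [pow_succ']
    exact annihilatedBy_mul_of_triangle hT (h0 _ hY) (ih _ hZ)

end Annihilators

instance {R : Type*} [CommRing R] {C : Type*} [Category* C] [Preadditive C] [Linear R C]
    [HasShift C ℤ] [∀ n : ℤ, (shiftFunctor C n).Linear R] (T : ObjectProperty C)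
    [T.IsStableUnderShift ℤ] (n : ℤ) : (shiftFunctor T.FullSubcategory n).Linear R where
  map_smul f r := by
    apply T.ι.map_injective
    rw [← cancel_mono ((T.ι.commShiftIso n).hom.app _), T.ι.commShiftIso_hom_naturality,
      CategoryTheory.Functor.map_smul, CategoryTheory.Functor.map_smul,
      CategoryTheory.Functor.map_smul, Linear.smul_comp, T.ι.commShiftIso_hom_naturality,
      Linear.comp_smul]

/-! ### Morphisms factoring through a triangulated subcategory -/

section Negligible

variable {C : Type*} [Category* C] [Preadditive C] [HasZeroObject C] [HasShift C ℤ]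
  [∀ n : ℤ, (shiftFunctor C n).Additive] [Pretriangulated C]

/-- A morphism `f : X ⟶ M` is negligible with respect to a triangulated subcategory `T` if it
becomes zero in the Verdier quotient by `T`, that is, if it vanishes on some `X' ⟶ X` whose cone
is in `T`. Equivalently, `f` factors through an object of `T`, see
`Negligible.exists_factorization` and `negligible_comp_of_prop`. -/
def Negligible (T : ObjectProperty C) {X M : C} (f : X ⟶ M) : Prop :=
  ∃ (X' : C) (s : X' ⟶ X), T.trW s ∧ s ≫ f = 0

/-- The objects `M` such that every morphism to `M` from an object of `P` is negligible. -/
def negligibleFrom (P T : ObjectProperty C) : ObjectProperty C :=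
  fun M ↦ ∀ ⦃X : C⦄ (f : X ⟶ M), P X → Negligible T f

variable {P T : ObjectProperty C}

theorem Negligible.exists_factorization {X M : C} {f : X ⟶ M} (hf : Negligible T f) :
    ∃ (Z : C) (g : X ⟶ Z) (h : Z ⟶ M), T Z ∧ g ≫ h = f := by
  obtain ⟨X', s, ⟨Z, g, k, hT, hZ⟩, hs⟩ := hf
  obtain ⟨h, hh⟩ := Triangle.yoneda_exact₂ _ hT f hs
  exact ⟨Z, g, h, hZ, hh.symm⟩

theorem Negligible.comp {X M N : C} {f : X ⟶ M} (hf : Negligible T f) (g : M ⟶ N) :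
    Negligible T (f ≫ g) := by
  obtain ⟨X', s, hs, h⟩ := hf
  exact ⟨X', s, hs, by rw [← Category.assoc, h, zero_comp]⟩

theorem negligible_of_prop {X M : C} (f : X ⟶ M) (hM : T M) : Negligible T f := by
  obtain ⟨X', s, k, hT⟩ := distinguished_cocone_triangle₁ f
  exact ⟨X', s, ⟨M, f, k, hT, hM⟩, comp_distTriang_mor_zero₁₂ _ hT⟩

theorem negligible_comp_of_prop {X Z M : C} (g : X ⟶ Z) (h : Z ⟶ M) (hZ : T Z) :
    Negligible T (g ≫ h) :=
  (negligible_of_prop g hZ).comp h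

theorem le_negligibleFrom : T ≤ negligibleFrom P T :=
  fun _ hM _ f _ ↦ negligible_of_prop f hM

variable [T.IsTriangulated]

theorem negligible_zero (X M : C) : Negligible T (0 : X ⟶ M) :=
  ⟨X, 𝟙 X, T.trW.id_mem X, by simp⟩

theorem negligibleFrom_of_isZero {M : C} (hM : IsZero M) : negligibleFrom P T M := by
  intro X f _
  rw [hM.eq_of_tgt f 0]
  exact negligible_zero X M

instance : (negligibleFrom P T).IsClosedUnderIsomorphisms where
  of_iso e hM X f hX := by simpa using (hM (f ≫ e.inv) hX).comp e.hom

theorem Negligible.unshift {X M : C} {f : X ⟶ M} {n : ℤ} (hf : Negligible T (f⟦n⟧')) :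
    Negligible T f := by
  obtain ⟨Z, g, h, hZ, e⟩ := hf.exists_factorization
  have h1 : f = ((shiftFunctorCompIsoId C n (-n) (add_neg_cancel n)).inv.app X ≫ g⟦-n⟧') ≫
      h⟦-n⟧' ≫ (shiftFunctorCompIsoId C n (-n) (add_neg_cancel n)).hom.app M := by
    rw [Category.assoc, ← Functor.map_comp_assoc, e, shift_shift_neg']
    simp
  rw [h1]
  exact negligible_comp_of_prop _ _ (T.le_shift _ _ hZ)

instance [P.IsStableUnderShift ℤ] : (negligibleFrom P T).IsStableUnderShift ℤ where
  isStableUnderShiftBy n :=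
    { le_shift := fun M hM X f hX ↦ by
        refine Negligible.unshift (n := -n) ?_
        have h := (hM (f⟦-n⟧' ≫ (shiftShiftNeg M n).hom) (P.le_shift _ _ hX)).comp
          (shiftShiftNeg M n).inv
        rwa [Category.assoc, Iso.hom_inv_id, Category.comp_id] at h }

variable [IsTriangulated C]

theorem Negligible.of_precomp {X' X M : C} {s : X' ⟶ X} (hs : T.trW s) {f : X ⟶ M}
    (hf : Negligible T (s ≫ f)) : Negligible T f := by
  obtain ⟨X'', t, ht, h⟩ := hf
  exact ⟨X'', t ≫ s, T.trW.comp_mem _ _ ht hs, by simpa using h⟩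

/-- If `A ⟶ M ⟶ B` is distinguished and morphisms from `P` to `A` are negligible, then a morphism
`X ⟶ M` is negligible once its composition to `B` is: it lifts to `A` on some `X' ⟶ X` with cone in
`T`. That `P` contains such `X'` along with `X` is the hypothesis `hP`. -/
theorem Negligible.of_triangle {Tr : Triangle C} (hTr : Tr ∈ distTriang C)
    (hP : ∀ ⦃X' X : C⦄ (s : X' ⟶ X), T.trW s → P X → P X')
    (h₁ : negligibleFrom P T Tr.obj₁) {X : C} (hX : P X) (f : X ⟶ Tr.obj₂)
    (hf : Negligible T (f ≫ Tr.mor₂)) : Negligible T f := by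
  obtain ⟨X', s, hs, h⟩ := hf
  obtain ⟨g, hg⟩ := Triangle.coyoneda_exact₂ Tr hTr (s ≫ f) (by simpa using h)
  refine Negligible.of_precomp hs ?_
  rw [hg]
  exact (h₁ g (hP s hs hX)).comp _

theorem negligibleFrom_of_triangle {Tr : Triangle C} (hTr : Tr ∈ distTriang C)
    (hP : ∀ ⦃X' X : C⦄ (s : X' ⟶ X), T.trW s → P X → P X')
    (h₁ : negligibleFrom P T Tr.obj₁) (h₃ : negligibleFrom P T Tr.obj₃) :
    negligibleFrom P T Tr.obj₂ :=
  fun _ f hX ↦ Negligible.of_triangle hTr hP h₁ hX f (h₃ _ hX)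

end Negligible

/-! ### Cycles and functionals on a complex of projective modules -/

/-- Let `D : M' → M`, let `e` be an endomorphism of `M` with `e ∘ D = s • D` and `e ∘ e = s • e`,
where `s ∉ p`, and suppose that every linear map `M → R ⧸ p` killing the image of `D` kills the
image of `e`. Then, locally at `p`, the image of `e` is contained in that of `D`: up to `s`, the map
`e` is a projector on `M ⧸ range D`, so a functional on its image extends to `M ⧸ range D`. -/
theorem exists_smul_mem_range_of_forall_linearMap {R : Type*} [CommRing R] {M M' : Type*}
    [AddCommGroup M] [Module R M] [Module.Finite R M] [AddCommGroup M'] [Module R M']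
    (p : Ideal R) [hp : p.IsPrime] (D : M' →ₗ[R] M) (e : M →ₗ[R] M) {s : R} (hs : s ∉ p)
    (heD : ∀ x, e (D x) = s • D x) (hee : ∀ m, e (e m) = s • e m)
    (H : ∀ φ : M →ₗ[R] R ⧸ p, (∀ x, φ (D x) = 0) → ∀ m, φ (e m) = 0) :
    ∃ t ∉ p, ∀ m, t • e m ∈ LinearMap.range D := by
  by_contra! hcon
  let q := (LinearMap.range D).mkQ ∘ₗ e
  obtain ⟨ψ, hψ⟩ := exists_linearMap_quotient_ne_zero (N := LinearMap.range q) p (by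
    intro t ht
    obtain ⟨m, hm⟩ := hcon t ht
    refine ⟨⟨q m, m, rfl⟩, fun h0 ↦ hm ?_⟩
    have h1 : t • q m = 0 := congrArg Subtype.val h0
    rwa [← map_smul, LinearMap.comp_apply, Submodule.mkQ_apply,
      Submodule.Quotient.mk_eq_zero, map_smul] at h1)
  apply hψ
  ext ⟨_, m, rfl⟩
  have h1 := H (ψ ∘ₗ q.rangeRestrict) (fun x ↦ by
    have : q.rangeRestrict (D x) = 0 := by
      ext
      simp only [LinearMap.codRestrict_apply, q, LinearMap.comp_apply, heD,
        Submodule.mkQ_apply, LinearMap.rangeRestrict, ZeroMemClass.coe_zero,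
        Submodule.Quotient.mk_eq_zero]
      exact ⟨s • x, by simp⟩
    simp [this]) m
  have h2 : q.rangeRestrict (e m) = s • q.rangeRestrict m := by
    ext
    simp [q, hee]
  rw [LinearMap.comp_apply, h2, map_smul, Algebra.smul_def, mul_eq_zero] at h1
  refine h1.resolve_left fun h ↦ hs ?_
  rwa [Ideal.Quotient.algebraMap_eq, Ideal.Quotient.eq_zero_iff_mem] at h

variable {R : Type u} [CommRing R]

/-- A bounded complex `K` of finitely generated projective modules which, locally at the prime `p`,
is not contractible has a cycle `z` and a linear form `φ` with values in `R ⧸ p`, vanishing on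
boundaries, such that `φ z ≠ 0`. Otherwise, a contracting homotopy (up to a factor outside `p`) is
constructed by descending induction on the degree. -/
theorem exists_cycle_apply_ne_zero (K : CochainComplex (ModuleCat.{u} R) ℤ) (a b : ℤ)
    [K.IsStrictlyGE a] [K.IsStrictlyLE b] (hfin : ∀ i, Module.Finite R (K.X i))
    (hproj : ∀ i, Module.Projective R (K.X i)) (p : Ideal R) [p.IsPrime]
    (hK : ∀ s ∉ p, IsEmpty (Homotopy (s • 𝟙 K) 0)) :
    ∃ (i : ℤ) (z : K.X i) (φ : K.X i ⟶ ModuleCat.of R (R ⧸ p)),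
      (∀ k, K.d i k z = 0) ∧ (∀ j, K.d j i ≫ φ = 0) ∧ φ z ≠ 0 := by
  by_contra! H
  have key : ∀ n : ℕ, ∃ s ∉ p, ∃ h : ∀ i k, K.X i ⟶ K.X k, ∀ i j k, i + 1 = j → j + 1 = k →
      b - n < j → h j i ≫ K.d i j + K.d j k ≫ h k j = s • 𝟙 (K.X j) := by
    intro n
    induction n with
    | zero =>
      refine ⟨1, (Ideal.ne_top_iff_one p).1 (Ideal.IsPrime.ne_top inferInstance), 0,
        fun i j k _ _ hj ↦ ?_⟩
      exact (K.isZero_of_isStrictlyLE b j (by simpa using hj)).eq_of_src _ _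
    | succ n ih =>
      obtain ⟨s, hs, h, hh⟩ := ih
      obtain ⟨j, hj⟩ : ∃ j, j = b - n := ⟨_, rfl⟩
      -- By the homotopy in degree `j + 1`, the map `e` takes values in the cycles, and it is
      -- multiplication by `s` on cycles.
      let e : K.X j ⟶ K.X j := s • 𝟙 _ - K.d j (j + 1) ≫ h (j + 1) j
      have hed : e ≫ K.d j (j + 1) = 0 := by
        have h1 := congrArg (fun f ↦ K.d j (j + 1) ≫ f)
          (hh j (j + 1) (j + 1 + 1) rfl rfl (by omega))
        simp only [Preadditive.comp_add, HomologicalComplex.d_comp_d_assoc, zero_comp, add_zero,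
          Linear.comp_smul, Category.comp_id] at h1
        simp only [e, Preadditive.sub_comp, Linear.smul_comp, Category.id_comp, Category.assoc, h1,
          sub_self]
      have hdz : ∀ m k, K.d j k (e m) = 0 := by
        intro m k
        by_cases hk : j + 1 = k
        · subst hk
          exact ConcreteCategory.congr_hom hed m
        · rw [K.shape j k (by simpa using hk)]
          rfl
      have he : ∀ m, e m = s • m - h (j + 1) j (K.d j (j + 1) m) := fun m ↦ rfl
      obtain ⟨t, ht, htr⟩ := exists_smul_mem_range_of_forall_linearMap p (K.d (j - 1) j).hom e.hom
        hs (fun x ↦ by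
          have : K.d j (j + 1) (K.d (j - 1) j x) = 0 :=
            ConcreteCategory.congr_hom (K.d_comp_d (j - 1) j (j + 1)) x
          change e (K.d (j - 1) j x) = _
          rw [he, this, map_zero, sub_zero])
        (fun m ↦ by
          change e (e m) = _
          rw [he (e m), hdz, map_zero, sub_zero])
        (fun φ hφ m ↦ H j (e m) (ModuleCat.ofHom φ) (hdz m) (fun i ↦ by
          by_cases hi : i + 1 = j
          · obtain rfl : i = j - 1 := by omega
            ext x
            exact hφ x
          · rw [K.shape i j (by simpa using hi), zero_comp]))
      -- So `t • e` takes values in the boundaries; a lift to `K.X (j - 1)` is the next component.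
      obtain ⟨g, hg⟩ := Module.projective_lifting_property
        (K.d (j - 1) j).hom.rangeRestrict ((t • e.hom).codRestrict _ htr)
        (LinearMap.surjective_rangeRestrict _)
      have hg' : ModuleCat.ofHom g ≫ K.d (j - 1) j = t • e := by
        ext m
        exact congrArg Subtype.val (LinearMap.congr_fun hg m)
      refine ⟨t * s, fun hts ↦ (Ideal.IsPrime.mem_or_mem inferInstance hts).elim ht hs,
        fun i k ↦ if hik : i = j ∧ k = j - 1 then
          (K.XIsoOfEq hik.1).hom ≫ ModuleCat.ofHom g ≫ (K.XIsoOfEq hik.2).inv else t • h i k, ?_⟩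
      intro i' j' k' hi' hk' hj'
      beta_reduce
      rw [dif_neg (c := k' = j ∧ j' = j - 1) (by omega)]
      by_cases hjj : j' = j
      · subst hjj
        obtain rfl : i' = j' - 1 := by omega
        subst hk'
        rw [dif_pos ⟨rfl, rfl⟩]
        simp only [HomologicalComplex.XIsoOfEq_rfl, Iso.refl_hom, Iso.refl_inv, Category.id_comp,
          Category.comp_id, hg', e, Linear.comp_smul, smul_sub, sub_add_cancel, mul_smul]
      · rw [dif_neg (by omega)]
        have := hh i' j' k' hi' hk' (by push_cast at hj'; omega)
        rw [Linear.smul_comp, Linear.comp_smul, ← smul_add, this, mul_smul]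
  obtain ⟨s, hs, h, hh⟩ := key (b - a + 1).toNat
  have hh' : ∀ i j k, i + 1 = j → j + 1 = k →
      h j i ≫ K.d i j + K.d j k ≫ h k j = s • 𝟙 (K.X j) := by
    intro i j k hi hk
    by_cases hj : b - ((b - a + 1).toNat : ℤ) < j
    · exact hh i j k hi hk hj
    · exact (K.isZero_of_isStrictlyGE a j (by omega)).eq_of_src _ _
  refine (hK s hs).elim
    { hom := fun i j ↦ if j + 1 = i then h i j else 0
      zero := fun i j hij ↦ if_neg hij
      comm := fun j ↦ ?_ }
  rw [dNext_eq _ (show (ComplexShape.up ℤ).Rel j (j + 1) from rfl),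
    prevD_eq _ (show (ComplexShape.up ℤ).Rel (j - 1) j by simp)]
  simp only [if_true, sub_add_cancel, HomologicalComplex.zero_f, add_zero,
    HomologicalComplex.smul_f_apply, HomologicalComplex.id_f]
  rw [add_comm, hh' (j - 1) j (j + 1) (by simp) rfl]

/-! ### Objects of bounded projective amplitude -/

section BoundedProjective

variable {A : Type*} [Category* A] [Abelian A] [HasDerivedCategory.{w} A]

/-- The objects `X` of the derived category which, for some `n`, have no nonzero morphism to an
object concentrated in degrees `≤ n`. Bounded complexes of projective objects are examples. -/
def boundedProjective (A : Type*) [Category* A] [Abelian A] [HasDerivedCategory.{w} A] :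
    ObjectProperty (DerivedCategory A) :=
  fun X ↦ ∃ n : ℤ, ∀ (Y : DerivedCategory A), Y.IsLE n → ∀ f : X ⟶ Y, f = 0

instance : (boundedProjective A).IsStableUnderShift ℤ where
  isStableUnderShiftBy a :=
    { le_shift := by
        rintro X ⟨n, hX⟩
        refine ⟨n - a, fun Y hY f ↦ ?_⟩
        have hY' : (Y⟦-a⟧).IsLE n := DerivedCategory.TStructure.t.isLE_shift Y (n - a) (-a) n
        apply (shiftFunctor (DerivedCategory A) (-a)).map_injective
        rw [Functor.map_zero, ← cancel_epi (shiftShiftNeg X a).inv, comp_zero]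
        exact hX _ hY' _ }

theorem boundedProjective_of_triangle {T : Triangle (DerivedCategory A)} (hT : T ∈ distTriang _)
    (h₁ : boundedProjective A T.obj₁) (h₃ : boundedProjective A T.obj₃) :
    boundedProjective A T.obj₂ := by
  obtain ⟨n₁, h₁⟩ := h₁
  obtain ⟨n₃, h₃⟩ := h₃
  refine ⟨min n₁ n₃, fun Y hY f ↦ ?_⟩
  have hY₁ : Y.IsLE n₁ := DerivedCategory.TStructure.t.isLE_of_le Y _ _ (min_le_left n₁ n₃)
  have hY₃ : Y.IsLE n₃ := DerivedCategory.TStructure.t.isLE_of_le Y _ _ (min_le_right n₁ n₃)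
  obtain ⟨g, rfl⟩ := Triangle.yoneda_exact₂ T hT f (h₁ Y hY₁ _)
  rw [h₃ Y hY₃ g, comp_zero]

theorem boundedProjective_of_trW {T : ObjectProperty (DerivedCategory A)}
    (hT : T ≤ boundedProjective A) ⦃X' X : DerivedCategory A⦄ (s : X' ⟶ X) (hs : T.trW s)
    (hX : boundedProjective A X) : boundedProjective A X' := by
  obtain ⟨Z, g, h, hTr, hZ⟩ := hs
  exact boundedProjective_of_triangle (inv_rot_of_distTriang _ hTr)
    ((boundedProjective A).le_shift (-1) _ (hT _ hZ)) hX

theorem boundedProjective_Q_obj (K : CochainComplex A ℤ) (a b : ℤ) [K.IsStrictlyGE a]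
    [K.IsStrictlyLE b] [∀ i, Projective (K.X i)] :
    boundedProjective A (DerivedCategory.Q.obj K) := by
  refine ⟨a - 1, fun Y hY f ↦ ?_⟩
  obtain ⟨L, hL, ⟨e⟩⟩ := Y.exists_iso_Q_obj_of_isLE (a - 1)
  have := CochainComplex.isKProjective_of_projective K b
  obtain ⟨g, hg⟩ := (CochainComplex.IsKProjective.Qh_map_bijective K
    ((HomotopyCategory.quotient A (.up ℤ)).obj L)).surjective
    ((DerivedCategory.quotientCompQhIso A).hom.app K ≫ f ≫ e.hom ≫
      (DerivedCategory.quotientCompQhIso A).inv.app L)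
  obtain ⟨k, rfl⟩ := (HomotopyCategory.quotient A (.up ℤ)).map_surjective g
  have hk : k = 0 := by
    ext i
    by_cases hi : i < a
    · exact (K.isZero_of_isStrictlyGE a i hi).eq_of_src _ _
    · exact (L.isZero_of_isStrictlyLE (a - 1) i (by omega)).eq_of_tgt _ _
  rw [hk, Functor.map_zero, Functor.map_zero] at hg
  rw [← cancel_mono e.hom, ← cancel_mono ((DerivedCategory.quotientCompQhIso A).inv.app L),
    ← cancel_epi ((DerivedCategory.quotientCompQhIso A).hom.app K), Category.assoc, ← hg]
  simp

end BoundedProjective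

variable {R : Type u} [CommRing R]

theorem perf_le_boundedProjective [HasDerivedCategory.{w} (ModuleCat.{u} R)] :
    Perf R ≤ boundedProjective (ModuleCat.{u} R) := by
  rintro X ⟨K, ⟨a, b, ha, hb⟩, hK, ⟨e⟩⟩
  have : ∀ i, Projective (K.X i) := fun i ↦ by
    have := (hK i).2
    infer_instance
  obtain ⟨n, hn⟩ := boundedProjective_Q_obj K a b
  refine ⟨n, fun Y hY f ↦ ?_⟩
  rw [← cancel_epi e.inv, comp_zero]
  exact hn Y hY _

/-! ### The tensor product of a complex and a module -/

section TensorComplex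

open MonoidalCategory

/-- The functor sending a module `M` to the complex `K ⊗ M`, tensored termwise. -/
noncomputable def tensorComplex (K : CochainComplex (ModuleCat.{u} R) ℤ) :
    ModuleCat.{u} R ⥤ CochainComplex (ModuleCat.{u} R) ℤ where
  obj M :=
    { X := fun i ↦ K.X i ⊗ M
      d := fun i j ↦ K.d i j ▷ M
      shape := fun i j h ↦ by rw [K.shape i j h, MonoidalPreadditive.zero_whiskerRight]
      d_comp_d' := fun i j k _ _ ↦ by
        rw [← comp_whiskerRight, K.d_comp_d, MonoidalPreadditive.zero_whiskerRight] }
  map f :=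
    { f := fun i ↦ K.X i ◁ f
      comm' := fun i j _ ↦ whisker_exchange _ _ }

instance (K : CochainComplex (ModuleCat.{u} R) ℤ) : (tensorComplex K).Additive where
  map_add {M N f g} := by
    ext i : 1
    exact MonoidalPreadditive.whiskerLeft_add _ _

/-- Tensoring with the base ring does not change the complex. -/
noncomputable def tensorComplexUnitIso (K : CochainComplex (ModuleCat.{u} R) ℤ) :
    (tensorComplex K).obj (ModuleCat.of R R) ≅ K :=
  HomologicalComplex.Hom.isoOfComponents (fun i ↦ ρ_ (K.X i))
    (fun i j _ ↦ (rightUnitor_naturality (K.d i j)).symm)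

theorem tensorComplex_map_shortExact (K : CochainComplex (ModuleCat.{u} R) ℤ)
    (hK : ∀ i, Module.Flat R (K.X i)) {S : ShortComplex (ModuleCat.{u} R)} (hS : S.ShortExact) :
    (S.map (tensorComplex K)).ShortExact := by
  apply HomologicalComplex.shortExact_of_degreewise_shortExact
  intro i
  have := hK i
  exact hS.map_of_exact (tensorLeft (K.X i))

instance (K : CochainComplex (ModuleCat.{u} R) ℤ) (M : ModuleCat.{u} R) (b : ℤ)
    [K.IsStrictlyLE b] : ((tensorComplex K).obj M).IsStrictlyLE b := by
  rw [CochainComplex.isStrictlyLE_iff]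
  intro i hi
  exact (tensorRight M).map_isZero (K.isZero_of_isStrictlyLE b i hi)

end TensorComplex

theorem moduleCat_shortExact_mk {N₁ N₂ N₃ : Type u} [AddCommGroup N₁] [AddCommGroup N₂]
    [AddCommGroup N₃] [Module R N₁] [Module R N₂] [Module R N₃] (f : N₁ →ₗ[R] N₂)
    (g : N₂ →ₗ[R] N₃) (hf : Function.Injective f) (hg : Function.Surjective g)
    (hfg : Function.Exact f g) :
    (ShortComplex.mk (ModuleCat.ofHom f) (ModuleCat.ofHom g)
      (by ext x; exact hfg.apply_apply_eq_zero x)).ShortExact where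
  exact := (ShortComplex.ShortExact.moduleCat_exact_iff_function_exact _).2 hfg
  mono_f := (ModuleCat.mono_iff_injective _).2 hf
  epi_g := (ModuleCat.epi_iff_surjective _).2 hg

section TensorNegligible

variable [HasDerivedCategory.{w} (ModuleCat.{u} R)]
  {P T : ObjectProperty (DerivedCategory (ModuleCat.{u} R))} [T.IsTriangulated]

/-- If `K` is in `T`, then morphisms to `K ⊗ F` with `F` finite free are negligible. -/
theorem negligibleFrom_tensorComplex_pi (K : CochainComplex (ModuleCat.{u} R) ℤ)
    (hK : ∀ i, Module.Flat R (K.X i))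
    (hP : ∀ ⦃X' X : DerivedCategory (ModuleCat.{u} R)⦄ (s : X' ⟶ X), T.trW s → P X → P X')
    (hT : negligibleFrom P T (DerivedCategory.Q.obj K)) (n : ℕ) :
    negligibleFrom P T
      (DerivedCategory.Q.obj ((tensorComplex K).obj (ModuleCat.of R (Fin n → R)))) := by
  induction n with
  | zero =>
    apply negligibleFrom_of_isZero
    apply Functor.map_isZero
    apply Functor.map_isZero
    exact ModuleCat.isZero_of_subsingleton _
  | succ n ih =>
    have hS := moduleCat_shortExact_mk (LinearMap.single R (fun _ : Fin (n + 1) ↦ R) 0)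
      (LinearMap.funLeft R R Fin.succ) (fun x y h ↦ by simpa using congrFun h 0)
      (LinearMap.funLeft_surjective_of_injective _ _ _ (Fin.succ_injective n))
      (fun x ↦ ⟨fun h ↦ ⟨x 0, by
          ext i
          refine Fin.cases ?_ (fun j ↦ ?_) i
          · simp
          · have := congrFun h j
            simpa using this.symm⟩, by
          rintro ⟨y, rfl⟩
          ext j
          simp [LinearMap.funLeft]⟩)
    exact negligibleFrom_of_triangle
      (DerivedCategory.triangleOfSES_distinguished (tensorComplex_map_shortExact K hK hS)) hP
      ((negligibleFrom P T).prop_of_iso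
        (DerivedCategory.Q.mapIso (tensorComplexUnitIso K).symm) hT) ih

variable [IsNoetherianRing R]

/-- If a bounded above complex `K` of flat modules is in `T`, then morphisms from perfect complexes
to `K ⊗ M` with `M` finitely generated are negligible: in a resolution of `M` by finite free
modules, only finitely many terms are seen by a given perfect complex. -/
theorem negligibleFrom_tensorComplex (K : CochainComplex (ModuleCat.{u} R) ℤ)
    (hK : ∀ i, Module.Flat R (K.X i)) (b : ℤ) [K.IsStrictlyLE b]
    (hT : T ≤ boundedProjective (ModuleCat.{u} R)) (hKT : T (DerivedCategory.Q.obj K))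
    (M : ModuleCat.{u} R) [Module.Finite R M] :
    negligibleFrom (boundedProjective (ModuleCat.{u} R)) T
      (DerivedCategory.Q.obj ((tensorComplex K).obj M)) := by
  intro X f hX
  obtain ⟨c, hc⟩ := hX
  -- Descending induction on the shift `i`, starting where there are no nonzero morphisms at all.
  have key : ∀ (m : ℕ) (i : ℤ) (_ : b - c ≤ i + m) (M : ModuleCat.{u} R) [Module.Finite R M]
      (g : X ⟶ (DerivedCategory.Q.obj ((tensorComplex K).obj M))⟦i⟧), Negligible T g := by
    intro m
    induction m with
    | zero =>
      intro i hi M _ g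
      have : (DerivedCategory.Q.obj ((tensorComplex K).obj M)).IsLE b := inferInstance
      have : (DerivedCategory.Q.obj ((tensorComplex K).obj M)).IsLE (i + c) :=
        DerivedCategory.TStructure.t.isLE_of_le _ b _ (by push_cast at hi; omega)
      rw [hc _ (DerivedCategory.TStructure.t.isLE_shift _ (i + c) i c rfl) g]
      exact negligible_zero _ _
    | succ m ih =>
      intro i hi M _ g
      obtain ⟨n, π, hπ⟩ := Module.Finite.exists_fin' R M
      have hS := LinearMap.shortExact_shortComplexKer hπ
      have hTr := Triangle.shift_distinguished _ (rot_of_distTriang _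
        (DerivedCategory.triangleOfSES_distinguished (tensorComplex_map_shortExact K hK hS))) i
      let e := (shiftFunctorAdd' (DerivedCategory (ModuleCat.{u} R)) 1 i (i + 1)
        (by ring)).app
          (DerivedCategory.Q.obj ((tensorComplex K).obj (ModuleCat.of R (LinearMap.ker π))))
      have hneg : ∀ g' : X ⟶ ((DerivedCategory.Q.obj
          ((tensorComplex K).obj (ModuleCat.of R (LinearMap.ker π))))⟦(1 : ℤ)⟧)⟦i⟧,
          Negligible T g' := by
        intro g'
        have := (ih (i + 1) (by push_cast at hi; omega) (ModuleCat.of R (LinearMap.ker π))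
          (g' ≫ e.inv)).comp e.hom
        rwa [Category.assoc, Iso.inv_hom_id, Category.comp_id] at this
      refine Negligible.of_triangle (P := boundedProjective (ModuleCat.{u} R)) hTr
        (boundedProjective_of_trW hT) ?_ ⟨c, hc⟩ g (hneg _)
      exact (negligibleFrom _ T).le_shift _ _ (negligibleFrom_tensorComplex_pi K hK
          (boundedProjective_of_trW hT) (le_negligibleFrom _ hKT) n)
  let e := (shiftFunctorZero (DerivedCategory (ModuleCat.{u} R)) ℤ).app
    (DerivedCategory.Q.obj ((tensorComplex K).obj M))
  have := (key (b - c).toNat 0 (by omega) M (f ≫ e.inv)).comp e.hom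
  rwa [Category.assoc, Iso.inv_hom_id, Category.comp_id] at this

end TensorNegligible

/-! ### Finitely generated modules supported on the support of a perfect complex -/

section

open scoped TensorProduct
open HomologicalComplex

/-- A cycle `z` of `K` and a linear form `φ` on `K` with values in `R ⧸ J` vanishing on boundaries
factor the multiplication by `φ z` on `R ⧸ J`, placed in the degree of `z`, through `K ⊗ R ⧸ J`. -/
theorem exists_single_factorization (K : CochainComplex (ModuleCat.{u} R) ℤ) (J : Ideal R) {i : ℤ}
    (z : K.X i) (φ : K.X i ⟶ ModuleCat.of R (R ⧸ J)) (hz : ∀ k, K.d i k z = 0)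
    (hφ : ∀ j, K.d j i ≫ φ = 0) (s : R) (hs : φ z = Ideal.Quotient.mk J s) :
    ∃ (α : (single _ (ComplexShape.up ℤ) i).obj (ModuleCat.of R (R ⧸ J)) ⟶
        (tensorComplex K).obj (ModuleCat.of R (R ⧸ J)))
      (β : (tensorComplex K).obj (ModuleCat.of R (R ⧸ J)) ⟶
        (single _ (ComplexShape.up ℤ) i).obj (ModuleCat.of R (R ⧸ J))), α ≫ β = s • 𝟙 _ := by
  let M := ModuleCat.of R (R ⧸ J)
  let a : M ⟶ ((tensorComplex K).obj M).X i :=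
    ModuleCat.ofHom (TensorProduct.mk R (K.X i) (R ⧸ J) z)
  let b : ((tensorComplex K).obj M).X i ⟶ M :=
    ModuleCat.ofHom (TensorProduct.lift ((LinearMap.mul R (R ⧸ J)).comp φ.hom))
  have ha : ∀ k, a ≫ ((tensorComplex K).obj M).d i k = 0 := fun k ↦
    ModuleCat.hom_ext (LinearMap.ext fun x ↦ by
      change (K.d i k z) ⊗ₜ[R] x = 0
      rw [hz, TensorProduct.zero_tmul])
  have hb : ∀ j, ((tensorComplex K).obj M).d j i ≫ b = 0 := fun j ↦
    ModuleCat.hom_ext (TensorProduct.ext' fun y x ↦ by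
      have h : φ (K.d j i y) = 0 := ConcreteCategory.congr_hom (hφ j) y
      change φ (K.d j i y) * x = 0
      rw [h, zero_mul])
  have hab : a ≫ b = s • 𝟙 M :=
    ModuleCat.hom_ext (LinearMap.ext fun x ↦ by
      change φ z * x = s • x
      rw [hs, Algebra.smul_def, Ideal.Quotient.algebraMap_eq])
  refine ⟨mkHomFromSingle a fun k _ ↦ ha k, mkHomToSingle b fun j _ ↦ hb j, ?_⟩
  apply from_single_hom_ext
  rw [comp_f, mkHomFromSingle_f, mkHomToSingle_f, Category.assoc, reassoc_of% hab, Linear.smul_comp,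
    Linear.comp_smul, Category.id_comp, Iso.hom_inv_id, smul_f_apply, id_f]

end

section

variable [HasDerivedCategory.{w} (ModuleCat.{u} R)]

/-- That the multiples `s • f` of all morphisms to an object are negligible is invariant under
shifts of the object. -/
theorem Negligible.smul_of_iso_shift {T : ObjectProperty (DerivedCategory (ModuleCat.{u} R))}
    [T.IsTriangulated] {P : ObjectProperty (DerivedCategory (ModuleCat.{u} R))}
    [P.IsStableUnderShift ℤ] {M N : DerivedCategory (ModuleCat.{u} R)} {i : ℤ} (e : N ≅ M⟦i⟧)
    {s : R} (hN : ∀ ⦃X⦄ (f : X ⟶ N), P X → Negligible T (s • f)) ⦃X⦄ (f : X ⟶ M) (hX : P X) :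
    Negligible T (s • f) := by
  refine Negligible.unshift (n := i) ?_
  have := (hN (f⟦i⟧' ≫ e.inv) (P.le_shift _ _ hX)).comp e.hom
  rwa [Linear.smul_comp, Category.assoc, Iso.inv_hom_id, Category.comp_id,
    ← CategoryTheory.Functor.map_smul] at this

variable {T : ObjectProperty (DerivedCategory (ModuleCat.{u} R))}
  [T.IsTriangulated]

variable (T) in
/-- The modules `M` such that every morphism in the derived category from an object of bounded
projective amplitude to `M`, placed in degree `0`, factors through an object of `T`. -/
def NegligibleModule (M : Type u) [AddCommGroup M] [Module R M] : Prop :=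
  negligibleFrom (boundedProjective (ModuleCat.{u} R)) T
    ((DerivedCategory.singleFunctor (ModuleCat.{u} R) 0).obj (ModuleCat.of R M))

theorem NegligibleModule.of_exact (hT : T ≤ boundedProjective (ModuleCat.{u} R))
    {N₁ N₂ N₃ : Type u} [AddCommGroup N₁] [AddCommGroup N₂]
    [AddCommGroup N₃] [Module R N₁] [Module R N₂] [Module R N₃] (f : N₁ →ₗ[R] N₂)
    (g : N₂ →ₗ[R] N₃) (hf : Function.Injective f) (hg : Function.Surjective g)
    (hfg : Function.Exact f g) (h₁ : NegligibleModule T N₁) (h₃ : NegligibleModule T N₃) :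
    NegligibleModule T N₂ :=
  negligibleFrom_of_triangle
    (moduleCat_shortExact_mk f g hf hg hfg).singleTriangle_distinguished
    (boundedProjective_of_trW hT) h₁ h₃
end

section

variable [HasDerivedCategory.{w} (ModuleCat.{u} R)]
  {T : ObjectProperty (DerivedCategory (ModuleCat.{u} R))} [T.IsTriangulated]

omit [T.IsTriangulated] in
theorem NegligibleModule.of_linearEquiv {M N : Type u} [AddCommGroup M] [Module R M]
    [AddCommGroup N] [Module R N] (e : M ≃ₗ[R] N) (h : NegligibleModule T M) :
    NegligibleModule T N :=
  (negligibleFrom _ T).prop_of_iso ((DerivedCategory.singleFunctor _ 0).mapIso e.toModuleIso) h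

theorem NegligibleModule.of_subsingleton (M : Type u) [AddCommGroup M] [Module R M]
    [Subsingleton M] : NegligibleModule T M :=
  negligibleFrom_of_isZero (Functor.map_isZero _ (ModuleCat.isZero_of_subsingleton _))

/-- At a prime `p` in the support of a perfect complex of `T`, some multiplication on `R ⧸ p` by an
element outside `p` factors through `K ⊗ R ⧸ p`, so it makes morphisms to `R ⧸ p` negligible. -/
theorem exists_negligible_smul [IsNoetherianRing R]
    (hT : T ≤ boundedProjective (ModuleCat.{u} R))
    (K : CochainComplex (ModuleCat.{u} R) ℤ) (a b : ℤ) [K.IsStrictlyGE a] [K.IsStrictlyLE b]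
    (hfin : ∀ i, Module.Finite R (K.X i)) (hproj : ∀ i, Module.Projective R (K.X i))
    (hKT : T (DerivedCategory.Q.obj K)) (p : Ideal R) [p.IsPrime]
    (hK : ∀ s ∉ p, IsEmpty (Homotopy (s • 𝟙 K) 0)) :
    ∃ s ∉ p, ∀ ⦃X : DerivedCategory (ModuleCat.{u} R)⦄
      (f : X ⟶ (DerivedCategory.singleFunctor (ModuleCat.{u} R) 0).obj (ModuleCat.of R (R ⧸ p))),
      boundedProjective (ModuleCat.{u} R) X → Negligible T (s • f) := by
  obtain ⟨i, z, φ, hz, hφ, hne⟩ := exists_cycle_apply_ne_zero K a b hfin hproj p hK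
  obtain ⟨s, hs⟩ := Ideal.Quotient.mk_surjective (φ z)
  obtain ⟨α, β, hαβ⟩ := exists_single_factorization K p z φ hz hφ s hs.symm
  refine ⟨s, fun hsp ↦ hne ?_, ?_⟩
  · rw [← hs]
    exact Ideal.Quotient.eq_zero_iff_mem.2 hsp
  · let e := ((DerivedCategory.singleFunctors (ModuleCat.{u} R)).shiftIso (-i) i 0
      (by simp)).app (ModuleCat.of R (R ⧸ p))
    intro X f hX
    refine Negligible.smul_of_iso_shift (P := boundedProjective (ModuleCat.{u} R)) e.symm ?_ f hX
    intro Y (g : Y ⟶ DerivedCategory.Q.obj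
      ((HomologicalComplex.single _ (ComplexShape.up ℤ) i).obj (ModuleCat.of R (R ⧸ p)))) hY
    have h1 := negligibleFrom_tensorComplex (T := T) K (fun i ↦ inferInstance) b hT hKT
      (ModuleCat.of R (R ⧸ p)) (g ≫ DerivedCategory.Q.map α) hY
    have h2 := h1.comp (DerivedCategory.Q.map β)
    rw [Category.assoc, ← Functor.map_comp, hαβ, CategoryTheory.Functor.map_smul,
      CategoryTheory.Functor.map_id, Linear.comp_smul, Category.comp_id] at h2
    exact h2

omit [HasDerivedCategory.{w} (ModuleCat.{u} R)] in
theorem factor_span_singleton_eq_zero_iff (J : Ideal R) (a : R) (y : R ⧸ J) :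
    Submodule.factor (le_sup_left : J ≤ J ⊔ Ideal.span {a}) y = 0 ↔
      ∃ r : R, r • Ideal.Quotient.mk J a = y := by
  obtain ⟨y, rfl⟩ := Ideal.Quotient.mk_surjective y
  have h : Submodule.factor (le_sup_left : J ≤ J ⊔ Ideal.span {a}) (Ideal.Quotient.mk J y) = 0 ↔
      y ∈ J ⊔ Ideal.span {a} := Ideal.Quotient.eq_zero_iff_mem
  have hsmul : ∀ r : R, r • Ideal.Quotient.mk J a = Ideal.Quotient.mk J (r * a) := fun r ↦ by
    rw [map_mul, Algebra.smul_def, Ideal.Quotient.algebraMap_eq]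
  rw [h, Submodule.mem_sup]
  constructor
  · rintro ⟨j, hj, _, hr, rfl⟩
    obtain ⟨r, rfl⟩ := Ideal.mem_span_singleton'.1 hr
    exact ⟨r, by rw [hsmul, map_add, Ideal.Quotient.eq_zero_iff_mem.2 hj, zero_add]⟩
  · rintro ⟨r, hr⟩
    rw [hsmul, eq_comm, Ideal.Quotient.eq] at hr
    exact ⟨y - r * a, hr, r * a, Ideal.mem_span_singleton'.2 ⟨r, rfl⟩, by ring⟩

/-- Negligibility of `R ⧸ J` by the exact sequence
`0 → R ⧸ (J : a) → R ⧸ J → R ⧸ (J + (a)) → 0`; the ideal `(J : a)` appears as the kernel of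
`R → R ⧸ J`, `1 ↦ a`. -/
theorem NegligibleModule.quotient_of_colon (hT : T ≤ boundedProjective (ModuleCat.{u} R))
    (J : Ideal R) (a : R)
    (h₁ : NegligibleModule T (R ⧸ LinearMap.ker (LinearMap.toSpanSingleton R (R ⧸ J)
      (Ideal.Quotient.mk J a))))
    (h₃ : NegligibleModule T (R ⧸ (J ⊔ Ideal.span {a}))) : NegligibleModule T (R ⧸ J) := by
  refine NegligibleModule.of_exact hT
    (Submodule.liftQ _ (LinearMap.toSpanSingleton R (R ⧸ J) (Ideal.Quotient.mk J a)) le_rfl)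
    (Submodule.factor (le_sup_left : J ≤ J ⊔ Ideal.span {a})) ?_ (Submodule.factor_surjective _)
    ?_ h₁ h₃
  · rw [← LinearMap.ker_eq_bot]
    exact Submodule.ker_liftQ_eq_bot _ _ _ le_rfl
  · intro y
    rw [factor_span_singleton_eq_zero_iff]
    constructor
    · rintro ⟨r, rfl⟩
      exact ⟨Ideal.Quotient.mk _ r, rfl⟩
    · rintro ⟨r, rfl⟩
      obtain ⟨r, rfl⟩ := Submodule.Quotient.mk_surjective _ r
      exact ⟨r, rfl⟩

/-- Let `s` be a nonzerodivisor on `R ⧸ p` making morphisms to `R ⧸ p` negligible. Then these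
morphisms are negligible as soon as those to `R ⧸ (p + (s))` are. -/
theorem NegligibleModule.quotient_of_smul (hT : T ≤ boundedProjective (ModuleCat.{u} R))
    (p : Ideal R) [p.IsPrime] {s : R} (hs : s ∉ p)
    (hneg : ∀ ⦃X : DerivedCategory (ModuleCat.{u} R)⦄
      (f : X ⟶ (DerivedCategory.singleFunctor (ModuleCat.{u} R) 0).obj (ModuleCat.of R (R ⧸ p))),
      boundedProjective (ModuleCat.{u} R) X → Negligible T (s • f))
    (h : NegligibleModule T (R ⧸ (p ⊔ Ideal.span {s}))) : NegligibleModule T (R ⧸ p) := by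
  have hS := moduleCat_shortExact_mk (LinearMap.lsmul R (R ⧸ p) s)
    (Submodule.factor (le_sup_left : p ≤ p ⊔ Ideal.span {s}))
    (by
      rw [← LinearMap.ker_eq_bot, LinearMap.ker_eq_bot']
      intro x hx
      rw [LinearMap.lsmul_apply, Algebra.smul_def, mul_eq_zero] at hx
      exact hx.resolve_left fun h ↦ hs (Ideal.Quotient.eq_zero_iff_mem.1 h))
    (Submodule.factor_surjective _)
    (fun y ↦ by
      rw [factor_span_singleton_eq_zero_iff]
      constructor
      · rintro ⟨r, rfl⟩
        exact ⟨Ideal.Quotient.mk p r, by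
          rw [LinearMap.lsmul_apply, Algebra.smul_def, Algebra.smul_def, mul_comm]; rfl⟩
      · rintro ⟨r, rfl⟩
        obtain ⟨r, rfl⟩ := Ideal.Quotient.mk_surjective r
        exact ⟨r, by
          rw [LinearMap.lsmul_apply, Algebra.smul_def, Algebra.smul_def, mul_comm]; rfl⟩)
  intro X f hX
  refine Negligible.of_triangle (P := boundedProjective (ModuleCat.{u} R))
    (inv_rot_of_distTriang _ hS.singleTriangle_distinguished) (boundedProjective_of_trW hT)
    ((negligibleFrom _ T).le_shift _ _ h) hX f ?_
  have hmap : (DerivedCategory.singleFunctor (ModuleCat.{u} R) 0).map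
      (ModuleCat.ofHom (LinearMap.lsmul R (R ⧸ p) s)) = s • 𝟙 _ := by
    rw [← CategoryTheory.Functor.map_id, ← CategoryTheory.Functor.map_smul]
    rfl
  change Negligible T (f ≫ (DerivedCategory.singleFunctor (ModuleCat.{u} R) 0).map
      (ModuleCat.ofHom (LinearMap.lsmul R (R ⧸ p) s)))
  rw [hmap, Linear.comp_smul, Category.comp_id]
  exact hneg f hX

/-- Noetherian induction: if the condition on multiplications holds for all primes containing `I`,
then all cyclic modules annihilated by a power of `I` are negligible. -/
theorem negligibleModule_quotient [IsNoetherianRing R]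
    (hT : T ≤ boundedProjective (ModuleCat.{u} R)) (I : Ideal R)
    (hI : ∀ (p : Ideal R) [p.IsPrime], I ≤ p →
      ∃ s ∉ p, ∀ ⦃X : DerivedCategory (ModuleCat.{u} R)⦄
        (f : X ⟶ (DerivedCategory.singleFunctor (ModuleCat.{u} R) 0).obj (ModuleCat.of R (R ⧸ p))),
        boundedProjective (ModuleCat.{u} R) X → Negligible T (s • f))
    (n : ℕ) (J : Ideal R) (hJ : I ^ n ≤ J) : NegligibleModule T (R ⧸ J) := by
  refine IsNoetherian.induction (P := fun J : Ideal R ↦ I ^ n ≤ J → NegligibleModule T (R ⧸ J))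
    (fun J ih hJ ↦ ?_) J hJ
  by_cases hJtop : J = ⊤
  · subst hJtop
    have : Subsingleton (R ⧸ (⊤ : Ideal R)) := Ideal.Quotient.subsingleton_iff.2 rfl
    exact NegligibleModule.of_subsingleton _
  have hsup : ∀ a ∉ J, NegligibleModule T (R ⧸ (J ⊔ Ideal.span {a})) := fun a ha ↦
    ih _ (lt_of_le_of_ne le_sup_left fun h ↦ ha (by
      rw [h]; exact Ideal.mem_sup_right (Ideal.mem_span_singleton_self a)))
      (hJ.trans le_sup_left)
  by_cases hprime : Ideal.IsPrime J
  · obtain ⟨s, hs, hneg⟩ := hI J (hprime.le_of_pow_le hJ)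
    exact NegligibleModule.quotient_of_smul hT J hs hneg (hsup s hs)
  · obtain ⟨a, ha, b, hb, hab⟩ := (Ideal.not_isPrime_iff.1 hprime).resolve_left hJtop
    have hmem : ∀ x, x ∈ LinearMap.ker (LinearMap.toSpanSingleton R (R ⧸ J)
        (Ideal.Quotient.mk J a)) ↔ x * a ∈ J := fun x ↦ by
      rw [LinearMap.mem_ker, LinearMap.toSpanSingleton_apply, ← Ideal.Quotient.eq_zero_iff_mem,
        map_mul, Algebra.smul_def]
      rfl
    have hle : J ≤ LinearMap.ker (LinearMap.toSpanSingleton R (R ⧸ J)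
        (Ideal.Quotient.mk J a)) := fun x hx ↦ (hmem x).2 (Ideal.mul_mem_right a J hx)
    refine NegligibleModule.quotient_of_colon hT J a (ih _ (lt_of_le_of_ne hle fun h ↦ hb ?_)
      (hJ.trans hle)) (hsup a ha)
    rw [h, hmem, mul_comm]
    exact hab

/-- Every finitely generated module has a finite filtration with quotients `R ⧸ p`. -/
theorem negligibleModule_of_finite [IsNoetherianRing R]
    (hT : T ≤ boundedProjective (ModuleCat.{u} R))
    (h : ∀ p : Ideal R, p.IsPrime → NegligibleModule T (R ⧸ p)) (M : Type u) [AddCommGroup M]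
    [Module R M] [hM : Module.Finite R M] : NegligibleModule T M := by
  induction hM using IsNoetherianRing.induction_on_isQuotientEquivQuotientPrime with
  | subsingleton N => exact NegligibleModule.of_subsingleton N
  | quotient N p e => exact (h _ p.2).of_linearEquiv e.symm
  | exact N₁ N₂ N₃ f g hf hg hfg h₁ h₃ => exact NegligibleModule.of_exact hT f g hf hg hfg h₁ h₃

/-- If all finitely generated modules are negligible, so are the bounded complexes of finitely
generated modules, by induction on the length: the term of top degree is a subcomplex. -/
theorem negligibleFrom_Q_obj (hT : T ≤ boundedProjective (ModuleCat.{u} R))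
    (h : ∀ (M : Type u) [AddCommGroup M] [Module R M] [Module.Finite R M], NegligibleModule T M)
    (n : ℕ) (K : CochainComplex (ModuleCat.{u} R) ℤ) (a b : ℤ) (hab : b < a + n)
    [K.IsStrictlyGE a] [K.IsStrictlyLE b] (hfin : ∀ i, Module.Finite R (K.X i)) :
    negligibleFrom (boundedProjective (ModuleCat.{u} R)) T (DerivedCategory.Q.obj K) := by
  induction n generalizing K b with
  | zero =>
    apply negligibleFrom_of_isZero
    apply Functor.map_isZero
    rw [IsZero.iff_id_eq_zero]
    ext i : 1
    by_cases hi : i < a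
    · exact (K.isZero_of_isStrictlyGE a i hi).eq_of_src _ _
    · exact (K.isZero_of_isStrictlyLE b i (by push_cast at hab; omega)).eq_of_src _ _
  | succ n ih =>
    let f := HomologicalComplex.mkHomFromSingle (c := ComplexShape.up ℤ) (K := K) (j := b)
      (𝟙 (K.X b)) (fun k hk ↦ (K.isZero_of_isStrictlyLE b k (by
        have : b + 1 = k := hk
        omega)).eq_of_tgt _ _)
    have hfb : IsIso (f.f b) := by
      rw [HomologicalComplex.mkHomFromSingle_f]
      infer_instance
    have : Mono f := by
      apply HomologicalComplex.mono_of_mono_f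
      intro i
      by_cases hi : i = b
      · subst hi
        infer_instance
      · exact ⟨fun g h _ ↦ (HomologicalComplex.isZero_single_obj_X _ _ _ _ hi).eq_of_tgt _ _⟩
    have hS : (ShortComplex.mk f (cokernel.π f) (cokernel.condition f)).ShortExact :=
      { exact := ShortComplex.exact_cokernel f }
    have hepi : ∀ i, Epi ((cokernel.π f).f i) := inferInstance
    have h₁ : negligibleFrom (boundedProjective (ModuleCat.{u} R)) T (DerivedCategory.Q.obj
        ((HomologicalComplex.single _ (ComplexShape.up ℤ) b).obj (K.X b))) := by
      let e := ((DerivedCategory.singleFunctors (ModuleCat.{u} R)).shiftIso (-b) b 0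
        (by simp)).app (K.X b)
      exact (negligibleFrom _ T).prop_of_iso e
        ((negligibleFrom _ T).le_shift _ _ (h (K.X b)))
    have hGE : CochainComplex.IsStrictlyGE (cokernel f) a := by
      rw [CochainComplex.isStrictlyGE_iff]
      intro i hi
      exact (K.isZero_of_isStrictlyGE a i hi).of_epi ((cokernel.π f).f i)
    have hLE : CochainComplex.IsStrictlyLE (cokernel f) (b - 1) := by
      rw [CochainComplex.isStrictlyLE_iff]
      intro i hi
      by_cases hib : i = b
      · subst hib
        have h0 : f.f i ≫ (cokernel.π f).f i = 0 := by
          rw [← HomologicalComplex.comp_f, cokernel.condition, HomologicalComplex.zero_f]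
        rw [IsZero.iff_id_eq_zero, ← cancel_epi ((cokernel.π f).f i), ← cancel_epi (f.f i),
          Category.comp_id, h0, comp_zero, comp_zero]
      · exact (K.isZero_of_isStrictlyLE b i (by omega)).of_epi ((cokernel.π f).f i)
    exact negligibleFrom_of_triangle (DerivedCategory.triangleOfSES_distinguished hS)
      (boundedProjective_of_trW hT) h₁
      (ih (cokernel f) (b - 1) (by push_cast at hab; omega) fun i ↦
        Module.Finite.of_surjective ((cokernel.π f).f i).hom
          ((ModuleCat.epi_iff_surjective _).1 (hepi i)))
end

/-! ### Regular thick subcategories -/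

instance (R : Type u) [CommRing R] [HasDerivedCategory.{w} (ModuleCat.{u} R)] :
    (Perf R).IsClosedUnderIsomorphisms where
  of_iso := by
    rintro X Y e ⟨K, hK, hK', ⟨e'⟩⟩
    exact ⟨K, hK, hK', ⟨e.symm ≪≫ e'⟩⟩

theorem IsThickIn.isClosedUnderIsomorphisms {C : Type*} [Category* C] {T P : ObjectProperty C}
    [P.IsClosedUnderIsomorphisms] (h : IsThickIn T P) : T.IsClosedUnderIsomorphisms where
  of_iso e hX := h.of_retract (P.prop_of_iso e (h.le _ hX)) hX (Retract.ofIso e.symm)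

theorem boundedProjective_single {R : Type u} [CommRing R]
    [HasDerivedCategory.{w} (ModuleCat.{u} R)] (M : Type u) [AddCommGroup M] [Module R M]
    [Module.Projective R M] : boundedProjective (ModuleCat.{u} R)
      ((DerivedCategory.singleFunctor (ModuleCat.{u} R) 0).obj (ModuleCat.of R M)) := by
  let K := (HomologicalComplex.single (ModuleCat.{u} R) (ComplexShape.up ℤ) 0).obj
    (ModuleCat.of R M)
  have hGE : CochainComplex.IsStrictlyGE K 0 := by
    rw [CochainComplex.isStrictlyGE_iff]
    exact fun i hi ↦ HomologicalComplex.isZero_single_obj_X _ _ _ _ hi.ne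
  have hLE : CochainComplex.IsStrictlyLE K 0 := by
    rw [CochainComplex.isStrictlyLE_iff]
    exact fun i hi ↦ HomologicalComplex.isZero_single_obj_X _ _ _ _ hi.ne'
  have : ∀ i, Projective (K.X i) := fun i ↦ by
    by_cases hi : i = 0
    · subst hi
      exact Projective.of_iso (HomologicalComplex.singleObjXSelf _ _ (ModuleCat.of R M)).symm
        inferInstance
    · exact (HomologicalComplex.isZero_single_obj_X _ _ _ _ hi).projective
  exact boundedProjective_Q_obj K 0 0

theorem IsIndecomposableRing.eq_zero_or_eq_one {R : Type u} [CommRing R]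
    (hR : IsIndecomposableRing R) {e : R} (he : IsIdempotentElem e) : e = 0 ∨ e = 1 := by
  have key : ∀ {x : R}, IsIdempotentElem x → Subsingleton (R ⧸ Ideal.span {x}) → x = 1 := by
    intro x hx h
    rw [Ideal.Quotient.subsingleton_iff, Ideal.span_singleton_eq_top] at h
    exact (IsIdempotentElem.iff_eq_one_of_isUnit h).1 hx
  have e₁ := (AlgEquiv.prodQuotientOfIsIdempotentElem R he he.one_sub (by simp)
      (by rw [mul_sub, mul_one, he.eq, sub_self])).toRingEquiv
  rcases hR _ _ ⟨e₁⟩ with h | h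
  · exact Or.inr (key he h)
  · exact Or.inl (by simpa using key he.one_sub h)

/-- If multiplication by `a` vanishes on all objects of `T` and `R ⧸ J` is negligible, then
`a ∈ J`: the projection `R → R ⧸ J` factors through an object of `T`. -/
theorem mem_of_annihilatedBy {R : Type u} [CommRing R]
    [HasDerivedCategory.{w} (ModuleCat.{u} R)]
    {T : ObjectProperty (DerivedCategory (ModuleCat.{u} R))} {J : Ideal R}
    (hJ : NegligibleModule T (R ⧸ J)) {a : R} (ha : ∀ X, T X → a • 𝟙 X = 0) : a ∈ J := by
  let π : ModuleCat.of R R ⟶ ModuleCat.of R (R ⧸ J) := ModuleCat.ofHom J.mkQ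
  obtain ⟨Z, g, h, hZ, hgh⟩ := (hJ ((DerivedCategory.singleFunctor (ModuleCat.{u} R) 0).map π)
    (boundedProjective_single R)).exists_factorization
  have h0 : (DerivedCategory.singleFunctor (ModuleCat.{u} R) 0).map (a • π) = 0 := by
    calc _ = g ≫ (a • 𝟙 Z) ≫ h := by
          rw [CategoryTheory.Functor.map_smul, ← hgh]
          simp
      _ = 0 := by rw [ha Z hZ]; simp
  have h1 : a • π = 0 := (DerivedCategory.singleFunctor (ModuleCat.{u} R) 0).map_injective
    (by rw [h0, Functor.map_zero])
  have h2 : a • Ideal.Quotient.mk J 1 = 0 := ConcreteCategory.congr_hom h1 (1 : R)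
  rw [Algebra.smul_def, map_one, mul_one] at h2
  exact Ideal.Quotient.eq_zero_iff_mem.1 h2

/-- If all modules `R ⧸ p` are negligible, the identity of a perfect complex is negligible, so that
the complex is a direct summand of an object of `T`. -/
theorem IsThickIn.perf_le {R : Type u} [CommRing R] [IsNoetherianRing R]
    [HasDerivedCategory.{w} (ModuleCat.{u} R)]
    {T : ObjectProperty (DerivedCategory (ModuleCat.{u} R))} [T.IsTriangulated]
    (hT : IsThickIn T (Perf R)) (h : ∀ p : Ideal R, p.IsPrime → NegligibleModule T (R ⧸ p)) :
    Perf R ≤ T := by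
  intro X hX
  have hbp := hT.le.trans perf_le_boundedProjective
  obtain ⟨K, ⟨a, b, _, _⟩, hK, ⟨e⟩⟩ := id hX
  have hneg := (negligibleFrom _ T).prop_of_iso e.symm (negligibleFrom_Q_obj hbp
    (fun M _ _ _ ↦ negligibleModule_of_finite hbp h M) (b - a + 1).toNat K a b (by omega)
    fun i ↦ (hK i).1)
  obtain ⟨Z, g, k, hZ, hgk⟩ := (hneg (𝟙 X) (perf_le_boundedProjective _ hX)).exists_factorization
  exact hT.of_retract hX hZ ⟨g, k, hgk⟩

theorem theorem3p3 (R : Type u) [CommRing R] [IsNoetherianRing R]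
    (hR : IsIndecomposableRing R) [HasDerivedCategory.{w} (ModuleCat.{u} R)]
    (T : ObjectProperty (DerivedCategory (ModuleCat.{u} R))) [T.IsTriangulated]
    (hT : IsThickIn T (Perf R))
    (hreg : IsRegularTriangulated T.FullSubcategory) :
    (∀ X, T X ↔ Limits.IsZero X) ∨ T = Perf R := by
  have := hT.isClosedUnderIsomorphisms
  have hbp := hT.le.trans perf_le_boundedProjective
  obtain ⟨G, n, hn⟩ := hreg
  let I : Ideal R := LinearMap.ker (LinearMap.toSpanSingleton R (G.obj ⟶ G.obj) (𝟙 G.obj))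
  have hI : ∀ a, a ∈ I ↔ a • 𝟙 G.obj = 0 := fun a ↦ by
    rw [LinearMap.mem_ker, LinearMap.toSpanSingleton_apply]
  have hkill : ∀ a ∈ I ^ (n + 1), ∀ X, T X → a • 𝟙 X = 0 := by
    intro a ha X hX
    have hG : ObjectProperty.singleton G ≤ annihilatedBy T.FullSubcategory I := by
      rintro _ ⟨⟩ a ha
      apply T.ι.map_injective
      rw [CategoryTheory.Functor.map_smul, CategoryTheory.Functor.map_id, Functor.map_zero]
      exact (hI a).1 ha
    have h := triangEnvelopeIter_le_annihilatedBy hG n ⟨X, hX⟩ (by rw [hn]; trivial) a ha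
    have h' := congrArg T.ι.map h
    rwa [CategoryTheory.Functor.map_smul, CategoryTheory.Functor.map_id, Functor.map_zero] at h'
  obtain ⟨K, ⟨a, b, _, _⟩, hK, ⟨e⟩⟩ := hT.le _ G.property
  have hcontr : ∀ p : Ideal R, I ≤ p → ∀ s ∉ p, IsEmpty (Homotopy (s • 𝟙 K) 0) := by
    refine fun p hp s hs ↦ ⟨fun h ↦ hs (hp ((hI s).2 ?_))⟩
    have h0 := DerivedCategory.Q_map_eq_of_homotopy _ h
    rw [CategoryTheory.Functor.map_smul, CategoryTheory.Functor.map_id, Functor.map_zero] at h0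
    calc s • 𝟙 G.obj = e.hom ≫ (s • 𝟙 (DerivedCategory.Q.obj K)) ≫ e.inv := by simp
      _ = 0 := by rw [h0]; simp
  have hneg := negligibleModule_quotient hbp I fun p _ hp ↦
    exists_negligible_smul hbp K a b (fun i ↦ (hK i).1) (fun i ↦ (hK i).2)
      (T.prop_of_iso e G.property) p (hcontr p hp)
  have hle : ∀ m, I ^ (n + 1) ≤ I ^ m := fun m a ha ↦
    mem_of_annihilatedBy (hneg m _ le_rfl) (hkill a ha)
  have hidem : IsIdempotentElem (I ^ (n + 1)) := by
    rw [IsIdempotentElem, ← pow_add]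
    exact le_antisymm (Ideal.pow_le_pow_right (by omega)) (hle _)
  obtain ⟨x, hx, hxI⟩ := (Ideal.isIdempotentElem_iff_of_fg _ (IsNoetherian.noetherian _)).1 hidem
  -- The two cases: `I` is nilpotent, or `I` is the unit ideal.
  rcases hR.eq_zero_or_eq_one hx with rfl | rfl
  · right
    refine le_antisymm hT.le (hT.perf_le fun p _ ↦ hneg (n + 1) p ?_)
    rw [hxI, Submodule.span_zero_singleton]
    exact bot_le
  · left
    refine fun X ↦ ⟨fun hX ↦ ?_, fun hX ↦ ?_⟩
    · rw [Limits.IsZero.iff_id_eq_zero, ← one_smul R (𝟙 X)]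
      exact hkill 1 (by rw [hxI]; exact Submodule.mem_span_singleton_self 1) X hX
    · obtain ⟨Z, hZ, hTZ⟩ := T.exists_prop_of_containsZero
      exact T.prop_of_iso (hZ.iso hX) hTZ
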